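/- For a finite set $S$ of positive integers let $\operatorname{mex} S$ be the least positive integer not in $S$. Define sequences $(A_n),(B_n),(C_n),(D_n)$, $n\ge 1$, by $A_1=1$, $B_1=2$, $C_1=3$, $D_n=A_n+B_n+C_n$ for all $n \ge 1$, and, with $S_n=\{A_i,B_i,C_i,D_i : 1\le i\le n\}$, $$A_{n+1}=\operatorname{mex}S_n,\quad B_{n+1}=\operatorname{mex}(S_n\cup\{A_{n+1}\}),\quad C_{n+1}=\operatorname{mex}(S_n\cup\{A_{n+1},B_{n+1}\})\qquad (n\ge 1).$$ (The $D_n = 6, 16, 27, 36, 46, \ldots$ are the anti-Tribonacci numbers, OEIS A265389; $A$, $B$, $C$ are A297464, A297465, A297466.) Then for all $n\ge1$ $$0\le 10n-6-3A_n\le 2,\quad 0\le 10n-2-3B_n\le 3,\quad 0\le 10n+1-3C_n\le 3,\quad 0\le 10n-3-D_n\le 2.$$ Moreover, each of the four remainder sequences $10n-6-3A_n$, $10n-2-3B_n$, $10n+1-3C_n$, $10n-3-D_n$, regarded as a sequence in $m=n-1\ge 0$, is $3$-automatic: there is a finite deterministic automaton with output that, on reading the base-$3$ digits of $m$, least significant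 digit first (possibly padded with zeros), outputs the term with index $m$. Finally, $A_{n+4}+A_n=A_{n+3}+A_{n+1}$ for all $n\ge1$. -/

import Mathlib

/-- The minimal excluded value of a finite set of natural numbers: the least positive integer
that is not in `S`. -/
noncomputable def mex (S : Finset ℕ) : ℕ := sInf {m : ℕ | 0 < m ∧ m ∉ S}

/-- The set of all the terms `A_i, B_i, C_i, D_i` with `1 ≤ i ≤ n`
(see `antiTribUsed_eq` below). Each step puts in the three next missing numbers `a < b < c`
and their sum. -/
noncomputable def antiTribUsed : ℕ → Finset ℕ
  | 0 => ∅
  | n + 1 =>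
    let S := antiTribUsed n
    let a := mex S
    let b := mex (insert a S)
    let c := mex (insert b (insert a S))
    S ∪ {a, b, c, a + b + c}

/-- `A_n` for `n ≥ 1` (the value at `0` has no meaning). -/
noncomputable def antiTribA (n : ℕ) : ℕ := mex (antiTribUsed (n - 1))

/-- `B_n` for `n ≥ 1`. -/
noncomputable def antiTribB (n : ℕ) : ℕ := mex (insert (antiTribA n) (antiTribUsed (n - 1)))

/-- `C_n` for `n ≥ 1`. -/
noncomputable def antiTribC (n : ℕ) : ℕ :=
  mex (insert (antiTribB n) (insert (antiTribA n) (antiTribUsed (n - 1))))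

/-- `D_n = A_n + B_n + C_n` for `n ≥ 1`: the anti-Tribonacci numbers. -/
noncomputable def antiTribD (n : ℕ) : ℕ := antiTribA n + antiTribB n + antiTribC n

/-- The terms in `antiTribUsed n` are exactly `A_i, B_i, C_i, D_i` with `1 ≤ i ≤ n`. -/
theorem antiTribUsed_eq (n : ℕ) :
    antiTribUsed n = (Finset.Icc 1 n).biUnion
      (fun i => {antiTribA i, antiTribB i, antiTribC i, antiTribD i}) := by
  induction n with
  | zero => simp [antiTribUsed]
  | succ n ih =>
    have h : antiTribUsed (n + 1) = antiTribUsed n ∪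
        {antiTribA (n + 1), antiTribB (n + 1), antiTribC (n + 1), antiTribD (n + 1)} := rfl
    rw [h, ← Finset.insert_Icc_right_eq_Icc_add_one (by omega), Finset.biUnion_insert, ← ih,
      Finset.union_comm]

/-- `mex S` is characterized as the least positive integer outside `S`. -/
theorem mex_isLeast (S : Finset ℕ) : IsLeast {m : ℕ | 0 < m ∧ m ∉ S} (mex S) := by
  have hne : {m : ℕ | 0 < m ∧ m ∉ S}.Nonempty := by
    obtain ⟨m, hm⟩ := Infinite.exists_notMem_finset (insert 0 S)
    rw [Finset.mem_insert, not_or] at hm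
    exact ⟨m, Nat.pos_of_ne_zero hm.1, hm.2⟩
  exact ⟨Nat.sInf_mem hne, fun m hm => Nat.sInf_le hm⟩

/-- The initial values are `A_1 = 1`, `B_1 = 2`, `C_1 = 3`. -/
theorem antiTrib_one : antiTribA 1 = 1 ∧ antiTribB 1 = 2 ∧ antiTribC 1 = 3 := by
  have hA : antiTribA 1 = 1 := by
    refine (mex_isLeast _).unique ⟨by simp [antiTribUsed], ?_⟩
    rintro m ⟨h, -⟩; omega
  have hB : antiTribB 1 = 2 := by
    refine (mex_isLeast _).unique ⟨by simp [antiTribUsed, hA], ?_⟩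
    rintro m ⟨h, h'⟩; simp [antiTribUsed, hA] at h'; omega
  refine ⟨hA, hB, (mex_isLeast _).unique ⟨by simp [antiTribUsed, hA, hB], ?_⟩⟩
  rintro m ⟨h, h'⟩; simp [antiTribUsed, hA, hB] at h'; omega

/-- A deterministic automaton with output: input alphabet `{0, …, k - 1}`, states `Q`,
outputs in `α`. -/
structure DFAO (k : ℕ) (Q α : Type*) where
  step : Q → Fin k → Q
  start : Q
  output : Q → α

/-- The output of the automaton after reading the word `w` from left to right. -/
def DFAO.eval {k : ℕ} {Q α : Type*} (M : DFAO k Q α) (w : List (Fin k)) : α :=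
  M.output (w.foldl M.step M.start)

/-- A sequence `(s_n)`, `n ≥ 0`, is `k`-automatic if some finite automaton with output returns
`s_n` whenever it reads a base-`k` representation of `n`, least significant digit first
(and possibly padded with zeros). -/
def IsAutomatic {α : Type*} (k : ℕ) (s : ℕ → α) : Prop :=
  ∃ (Q : Type) (_ : Finite Q) (M : DFAO k Q α),
    ∀ w : List (Fin k), M.eval w = s (Nat.ofDigits k (w.map Fin.val))

/-! The block `10j+1, …, 10j+10` consists of three triples and the single term `D_{j+1} =
10j+6+e_j`, `e_j ∈ {-1,0,1}`: the outer triples take the digits `1,2,3` and `8,9,10`, and the middle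
one takes what `D_{j+1}` leaves of `4,5,6,7`. The outer triples have digit sums `6` and `27`, so
`e_{3j} = 0` and `e_{3j+2} = 1`. The middle digits sum to `22-(6+e_j) = 10+(6-e_j)`, so `e_{3j+1} =
-e_j`. Thus `e` is `3`-automatic, and all four remainders depend only on `r` and `e_j`, where `n =
3j+r+1`. The induction is `mem_antiTribUsed`, with `antiTrib_triple` as its greedy step. -/

/-- A sequence belonging to a finite family that is closed under the decimations
`m ↦ a + k * m`, `a < k`, is `k`-automatic. -/
theorem IsAutomatic.of_decimation {α : Type*} {k : ℕ} {Q : Type} [Finite Q] (s : Q → ℕ → α)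
    (step : Q → Fin k → Q) (hs : ∀ q a m, s (step q a) m = s q (a + k * m)) (q : Q) :
    IsAutomatic k (s q) := by
  -- Each digit read replaces the current sequence by a decimation, so at the end of the word the
  -- index still to be read is `0`.
  refine ⟨Q, inferInstance, ⟨step, q, fun q => s q 0⟩, fun w => ?_⟩
  change s (w.foldl step q) 0 = _
  induction w generalizing q with
  | nil => simp
  | cons a w ih => rw [List.foldl_cons, ih, hs, List.map_cons, Nat.ofDigits_cons]

/-- The deviation of `D_{m+1}` from `10 m + 6`. -/
def antiTribSign (m : ℕ) : SignType :=
  if m % 3 = 0 then 0 else if m % 3 = 1 then -antiTribSign (m / 3) else 1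
termination_by m
decreasing_by omega

theorem antiTribSign_zero_add (m : ℕ) : antiTribSign (3 * m) = 0 := by
  rw [antiTribSign, if_pos (by omega)]

theorem antiTribSign_one_add (m : ℕ) : antiTribSign (3 * m + 1) = -antiTribSign m := by
  rw [antiTribSign, if_neg (by omega), if_pos (by omega), show (3 * m + 1) / 3 = m by omega]

theorem antiTribSign_two_add (m : ℕ) : antiTribSign (3 * m + 2) = 1 := by
  rw [antiTribSign, if_neg (by omega), if_neg (by omega)]

/-- A sequence determined by `m % 3` and `antiTribSign (m / 3)` is `3`-automatic. -/
theorem isAutomatic_of_antiTribSign {α : Type*} {s : ℕ → α} (F : Fin 3 → SignType → α)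
    (hs : ∀ (r : Fin 3) (j : ℕ), s (r + 3 * j) = F r (antiTribSign j)) : IsAutomatic 3 s := by
  -- After the first digit `r`, the state stores the map `h` still to be applied to the sign of the
  -- unread part. Digit `1` precomposes `h` with negation; digits `0` and `2` make it constant.
  let t : Option (Fin 3 × (SignType → SignType)) → ℕ → α
    | none => s
    | some (r, h) => fun m => F r (h (antiTribSign m))
  let step : Option (Fin 3 × (SignType → SignType)) → Fin 3 → Option (Fin 3 × (SignType → SignType))
    | none, r => some (r, id)
    | some (r, h), a => some (r, ![fun _ => h 0, fun e => h (-e), fun _ => h 1] a)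
  refine IsAutomatic.of_decimation t step ?_ none
  rintro (_ | ⟨r, h⟩) a m
  · exact (hs a m).symm
  · fin_cases a
    · simp [t, step, antiTribSign_zero_add]
    · simp [t, step, add_comm 1, antiTribSign_one_add]
    · simp [t, step, add_comm 2, antiTribSign_two_add]

/-- The last digit of `D_{m+1}` as a function of `antiTribSign m`. -/
def antiTribDigitD : SignType → ℕ
  | -1 => 5
  | 0 => 6
  | 1 => 7

/-- `A_{3j+r+1} - 10 j`. -/
def antiTribDigitA : Fin 3 → ℕ := ![1, 4, 8]

/-- `B_{3j+r+1} - 10 j` as a function of `r` and `antiTribSign j`. -/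
def antiTribDigitB (r : Fin 3) (e : SignType) : ℕ := ![2, if e = -1 then 6 else 5, 9] r

/-- `C_{3j+r+1} - 10 j` as a function of `r` and `antiTribSign j`. -/
def antiTribDigitC (r : Fin 3) (e : SignType) : ℕ := ![3, if e = 1 then 6 else 7, 10] r

theorem antiTribDigitD_bounds (e : SignType) : 5 ≤ antiTribDigitD e ∧ antiTribDigitD e ≤ 7 := by
  cases e <;> decide

/-- The sum of a triple ends in the digit prescribed by `antiTribSign`. -/
theorem antiTribDigit_sum (r : Fin 3) (j : ℕ) :
    antiTribDigitA r + antiTribDigitB r (antiTribSign j) + antiTribDigitC r (antiTribSign j) =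
      10 * (r : ℕ) + antiTribDigitD (antiTribSign (r + 3 * j)) := by
  fin_cases r
  · simp [antiTribSign_zero_add, antiTribDigitA, antiTribDigitB, antiTribDigitC]; rfl
  · simp only [Fin.mk_one, add_comm 1, antiTribSign_one_add]
    generalize antiTribSign j = e
    cases e <;> decide
  · simp [add_comm 2, antiTribSign_two_add, antiTribDigitA, antiTribDigitB, antiTribDigitC]; rfl

theorem antiTribDigitA_cases (r : Fin 3) :
    (r = 0 ∧ (r : ℕ) = 0 ∧ antiTribDigitA r = 1) ∨
    (r = 1 ∧ (r : ℕ) = 1 ∧ antiTribDigitA r = 4) ∨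
    (r = 2 ∧ (r : ℕ) = 2 ∧ antiTribDigitA r = 8) := by
  revert r; decide

theorem mex_eq {S : Finset ℕ} {a : ℕ} (ha : 0 < a) (haS : a ∉ S)
    (h : ∀ x, 0 < x → x ∉ S → a ≤ x) : mex S = a :=
  (mex_isLeast S).unique ⟨⟨ha, haS⟩, fun x hx => h x hx.1 hx.2⟩

/-- The positions within a decade of a triple and, for the middle triple, of the `D` term lying among
or next to it. -/
theorem antiTribDigit_order (r : Fin 3) (e : SignType) :
    (r = 0 ∧ antiTribDigitA r = 1 ∧ antiTribDigitB r e = 2 ∧ antiTribDigitC r e = 3) ∨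
    (r = 2 ∧ antiTribDigitA r = 8 ∧ antiTribDigitB r e = 9 ∧ antiTribDigitC r e = 10) ∨
    (r = 1 ∧ antiTribDigitA r = 4 ∧
      (antiTribDigitD e = 5 ∧ antiTribDigitB r e = 6 ∧ antiTribDigitC r e = 7 ∨
       antiTribDigitD e = 6 ∧ antiTribDigitB r e = 5 ∧ antiTribDigitC r e = 7 ∨
       antiTribDigitD e = 7 ∧ antiTribDigitB r e = 5 ∧ antiTribDigitC r e = 6)) := by
  revert r e; decide

/-- If the used numbers are those below the next `A` and the earlier `D`s, then the next triple
consists of the predicted numbers. -/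
theorem antiTrib_triple {r : Fin 3} {j : ℕ}
    (h : ∀ x, x ∈ antiTribUsed (r + 3 * j) ↔ 0 < x ∧ (x < 10 * j + antiTribDigitA r ∨
      ∃ i < r + 3 * j, x = 10 * i + antiTribDigitD (antiTribSign i))) :
    antiTribA (r + 3 * j + 1) = 10 * j + antiTribDigitA r ∧
    antiTribB (r + 3 * j + 1) = 10 * j + antiTribDigitB r (antiTribSign j) ∧
    antiTribC (r + 3 * j + 1) = 10 * j + antiTribDigitC r (antiTribSign j) := by
  have hord := antiTribDigit_order r (antiTribSign j)
  have hr := antiTribDigitA_cases r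
  have hmem : ∀ x, x ∉ antiTribUsed (r + 3 * j) → 0 < x → 10 * j + antiTribDigitA r ≤ x ∧
      (r = 1 → x ≠ 10 * j + antiTribDigitD (antiTribSign j)) := by
    intro x hx hx0
    rw [h] at hx
    push Not at hx
    refine ⟨(hx hx0).1, fun h1 => (hx hx0).2 j (by rw [h1]; simp; omega)⟩
  -- Only `D_{j+1}` can lie in this block. For `r = 0` it may already be used, but it exceeds
  -- `10j+3`; for `r = 2` it lies below `10j+8`.
  have hnot : ∀ x, 10 * j + antiTribDigitA r ≤ x → x ≤ 10 * j + 10 →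
      (r = 1 → x ≠ 10 * j + antiTribDigitD (antiTribSign j)) →
      (r = 0 → x ≤ 10 * j + 3) → x ∉ antiTribUsed (r + 3 * j) := by
    intro x h1 h2 h3 h4 hx
    obtain ⟨-, hx | ⟨i, hi, hx⟩⟩ := (h x).1 hx
    · omega
    · have hb := antiTribDigitD_bounds (antiTribSign i)
      have hij : i = j := by omega
      subst hij
      omega
  have hA : antiTribA (r + 3 * j + 1) = 10 * j + antiTribDigitA r :=
    mex_eq (by omega) (hnot _ (by omega) (by omega) (by omega) (by omega))
      fun x hx0 hx => (hmem x hx hx0).1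
  have hB : antiTribB (r + 3 * j + 1) = 10 * j + antiTribDigitB r (antiTribSign j) := by
    refine mex_eq (by omega) ?_ fun x hx0 hx => ?_
    · rw [Finset.mem_insert, hA, not_or]
      exact ⟨by omega, hnot _ (by omega) (by omega) (by omega) (by omega)⟩
    · rw [Finset.mem_insert, hA, not_or] at hx
      have := hmem x hx.2 hx0
      omega
  refine ⟨hA, hB, mex_eq (by omega) ?_ fun x hx0 hx => ?_⟩
  · rw [Finset.mem_insert, Finset.mem_insert, hA, hB, not_or, not_or]
    exact ⟨by omega, by omega, hnot _ (by omega) (by omega) (by omega) (by omega)⟩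
  · rw [Finset.mem_insert, Finset.mem_insert, hA, hB, not_or, not_or] at hx
    have := hmem x hx.2.2 hx0
    omega

theorem antiTribUsed_succ (n : ℕ) : antiTribUsed (n + 1) = antiTribUsed n ∪
    {antiTribA (n + 1), antiTribB (n + 1), antiTribC (n + 1), antiTribD (n + 1)} := rfl

theorem exists_fin_three_add (n : ℕ) : ∃ (r : Fin 3) (j : ℕ), n = r + 3 * j :=
  ⟨⟨n % 3, by omega⟩, n / 3, by simp; omega⟩

/-- The used numbers are those below the next `A` and the earlier `D`s. -/
theorem mem_antiTribUsed (n : ℕ) : ∀ (r : Fin 3) (j : ℕ), n = r + 3 * j →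
    ∀ x, x ∈ antiTribUsed (r + 3 * j) ↔ 0 < x ∧ (x < 10 * j + antiTribDigitA r ∨
      ∃ i < r + 3 * j, x = 10 * i + antiTribDigitD (antiTribSign i)) := by
  induction n with
  | zero =>
    intro r j h x
    obtain rfl : r = 0 := by ext; simp; omega
    obtain rfl : j = 0 := by omega
    simp [antiTribUsed, antiTribDigitA]
    omega
  | succ n ih =>
    intro r j h x
    obtain ⟨r', j', rfl⟩ := exists_fin_three_add n
    have hU := ih r' j' rfl
    obtain ⟨hA, hB, hC⟩ := antiTrib_triple hU
    have hD : antiTribD (r' + 3 * j' + 1) =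
        10 * (r' + 3 * j') + antiTribDigitD (antiTribSign (r' + 3 * j')) := by
      have := antiTribDigit_sum r' j'
      rw [antiTribD, hA, hB, hC]
      omega
    have hb := antiTribDigitD_bounds (antiTribSign (r' + 3 * j'))
    have hord := antiTribDigit_order r' (antiTribSign j')
    have hr := antiTribDigitA_cases r
    have hr' := antiTribDigitA_cases r'
    rw [← h, antiTribUsed_succ, Finset.mem_union, hU]
    simp only [Finset.mem_insert, Finset.mem_singleton, hA, hB, hC, hD, Nat.lt_succ_iff_lt_or_eq,
      or_and_right, exists_or, exists_eq_left]
    constructor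
    · rintro (⟨h0, h1 | h1⟩ | h1 | h1 | h1 | h1)
      · exact ⟨h0, Or.inl (by omega)⟩
      · exact ⟨h0, Or.inr (Or.inl h1)⟩
      · exact ⟨by omega, Or.inl (by omega)⟩
      · exact ⟨by omega, Or.inl (by omega)⟩
      · exact ⟨by omega, Or.inl (by omega)⟩
      · exact ⟨by omega, Or.inr (Or.inr h1)⟩
    · rintro ⟨h0, h1 | h1 | h1⟩
      -- From one `A` up to the next, the only number outside the triple is `D_{j'+1}`, when `r' =
      -- 1`; it is already used, since `j' < 1 + 3j'`.
      · by_cases hx : r' = 1 ∧ x = 10 * j' + antiTribDigitD (antiTribSign j')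
        · exact Or.inl ⟨h0, Or.inr ⟨j', by omega, hx.2⟩⟩
        · by_cases hx' : x < 10 * j' + antiTribDigitA r'
          · exact Or.inl ⟨h0, Or.inl hx'⟩
          · right; omega
      · exact Or.inl ⟨h0, Or.inr h1⟩
      · exact Or.inr (Or.inr (Or.inr (Or.inr h1)))

theorem antiTrib_eq (r : Fin 3) (j : ℕ) :
    antiTribA (r + 3 * j + 1) = 10 * j + antiTribDigitA r ∧
    antiTribB (r + 3 * j + 1) = 10 * j + antiTribDigitB r (antiTribSign j) ∧
    antiTribC (r + 3 * j + 1) = 10 * j + antiTribDigitC r (antiTribSign j) :=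
  antiTrib_triple (mem_antiTribUsed _ r j rfl)

/-- The digit of `A` does not involve the sign, so `A` is exactly periodic modulo the shift by a
block. The four-term recurrence follows. -/
theorem antiTribA_add_three (n : ℕ) (hn : 1 ≤ n) : antiTribA (n + 3) = antiTribA n + 10 := by
  obtain ⟨m, rfl⟩ := Nat.exists_eq_add_of_le' hn
  obtain ⟨r, j, rfl⟩ := exists_fin_three_add m
  rw [(antiTrib_eq r j).1, show (r : ℕ) + 3 * j + 1 + 3 = r + 3 * (j + 1) + 1 by ring,
    (antiTrib_eq r (j + 1)).1]
  ring

theorem mainTheorem4 :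
    (∀ n : ℕ, 1 ≤ n →
      (0 ≤ 10 * (n : ℤ) - 6 - 3 * (antiTribA n : ℤ) ∧
        10 * (n : ℤ) - 6 - 3 * (antiTribA n : ℤ) ≤ 2) ∧
      (0 ≤ 10 * (n : ℤ) - 2 - 3 * (antiTribB n : ℤ) ∧
        10 * (n : ℤ) - 2 - 3 * (antiTribB n : ℤ) ≤ 3) ∧
      (0 ≤ 10 * (n : ℤ) + 1 - 3 * (antiTribC n : ℤ) ∧
        10 * (n : ℤ) + 1 - 3 * (antiTribC n : ℤ) ≤ 3) ∧
      (0 ≤ 10 * (n : ℤ) - 3 - (antiTribD n : ℤ) ∧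
        10 * (n : ℤ) - 3 - (antiTribD n : ℤ) ≤ 2)) ∧
    IsAutomatic 3 (fun m : ℕ => 10 * ((m + 1 : ℕ) : ℤ) - 6 - 3 * (antiTribA (m + 1) : ℤ)) ∧
    IsAutomatic 3 (fun m : ℕ => 10 * ((m + 1 : ℕ) : ℤ) - 2 - 3 * (antiTribB (m + 1) : ℤ)) ∧
    IsAutomatic 3 (fun m : ℕ => 10 * ((m + 1 : ℕ) : ℤ) + 1 - 3 * (antiTribC (m + 1) : ℤ)) ∧
    IsAutomatic 3 (fun m : ℕ => 10 * ((m + 1 : ℕ) : ℤ) - 3 - (antiTribD (m + 1) : ℤ)) ∧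
    (∀ n : ℕ, 1 ≤ n →
      antiTribA (n + 4) + antiTribA n = antiTribA (n + 3) + antiTribA (n + 1)) := by
  refine ⟨fun n hn => ?_, ?_, ?_, ?_, ?_, fun n hn => ?_⟩
  · obtain ⟨m, rfl⟩ := Nat.exists_eq_add_of_le' hn
    obtain ⟨r, j, rfl⟩ := exists_fin_three_add m
    obtain ⟨hA, hB, hC⟩ := antiTrib_eq r j
    have hord := antiTribDigit_order r (antiTribSign j)
    have hr := antiTribDigitA_cases r
    rw [antiTribD, hA, hB, hC]
    omega
  -- The contributions `30j` cancel, and `n = m+1` adds `10` to the constant: `-6` becomes `4`, and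
  -- similarly below.
  · refine isAutomatic_of_antiTribSign
      (fun r _ => 10 * (r : ℤ) + 4 - 3 * antiTribDigitA r) fun r j => ?_
    rw [(antiTrib_eq r j).1]
    push_cast
    ring
  · refine isAutomatic_of_antiTribSign
      (fun r e => 10 * (r : ℤ) + 8 - 3 * antiTribDigitB r e) fun r j => ?_
    rw [(antiTrib_eq r j).2.1]
    push_cast
    ring
  · refine isAutomatic_of_antiTribSign
      (fun r e => 10 * (r : ℤ) + 11 - 3 * antiTribDigitC r e) fun r j => ?_
    rw [(antiTrib_eq r j).2.2]
    push_cast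
    ring
  · refine isAutomatic_of_antiTribSign
      (fun r e => 10 * (r : ℤ) + 7 - (antiTribDigitA r + antiTribDigitB r e + antiTribDigitC r e))
      fun r j => ?_
    obtain ⟨hA, hB, hC⟩ := antiTrib_eq r j
    rw [antiTribD, hA, hB, hC]
    push_cast
    ring
  · rw [show n + 4 = n + 1 + 3 by ring, antiTribA_add_three n hn,
      antiTribA_add_three (n + 1) (by omega)]
    ring
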